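/- Let $G$ be a real (finite-dimensional, smooth) Lie group whose Lie algebra $\mathfrak g$ is semisimple, with Killing form $\langle\cdot,\cdot\rangle$. Let $\theta$ be a Cartan involution of $\mathfrak g$ with Cartan decomposition $\mathfrak g=\mathfrak k\oplus\mathfrak s$, and let $\mathfrak a\subset\mathfrak s$ be a splitting Cartan subalgebra of $\mathfrak g$ (so $\mathfrak g$ is a split real form). Let $\Pi$ be the set of roots of $(\mathfrak g,\mathfrak a)$ and $\Sigma\subset\Pi$ a simple system; write $\langle\alpha,\alpha\rangle=\alpha(H_\alpha)$, where $H_\alpha\in\mathfrak a$ is given by $\langle H_\alpha,H\rangle=\alpha(H)$ for $H\in\mathfrak a$. For every root $\gamma$ choose $X_\gamma\in\mathfrak g_\gamma$ such that $X_{-\gamma}=-\theta(X_\gamma)$ and $\langle X_\gamma,X_{-\gamma}\rangle=\frac{2}{\langle\gamma,\gamma\rangle}$, and put $$A_\gamma=X_\gamma-X_{-\gamma}\in\mathfrak g,\qquad s_\gamma=\exp\left(\tfrac{\pi}{2}A_\gamma\right)\in G,$$ where $\exp:\mathfrak g\to G$ is the exponential map. Suppose that $\alpha,\beta\in\Sigma$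 are joined by a double edge of the Dynkin diagram and that $\alpha$ is the short root (i.e. $2\langle\beta,\alpha\rangle/\langle\alpha,\alpha\rangle=-2$). Then, for every $t\in[0,\pi]$, \begin{align*} \exp(tA_\alpha)\, s_\beta\, s_\alpha\, s_\beta &= s_\beta\, s_\alpha\, s_\beta\,\exp(tA_\alpha),\\ s_\alpha\,\exp(tA_\beta)\, s_\alpha\, s_\beta &= s_\beta\, s_\alpha\,\exp(tA_\beta)\, s_\alpha,\\ s_\alpha\, s_\beta\,\exp(tA_\alpha)\, s_\beta &= s_\beta\,\exp((\pi-t)A_\alpha)\, s_\beta\, s_\alpha,\\ s_\alpha\, s_\beta\, s_\alpha\,\exp(tA_\beta) &= \exp(tA_\beta)\, s_\alpha\, s_\beta\, s_\alpha. \end{align*} -/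

import Mathlib

open scoped Manifold ContDiff

noncomputable section

/-- A smooth real Lie group is of the class `C^3` for which Mathlib provides the Lie bracket on
`GroupLieAlgebra`. -/
instance instLEInftyMinSmoothnessRealThree : ENat.LEInfty (minSmoothness ℝ 3) := by
  rw [minSmoothness_of_isRCLikeNormedField]
  infer_instance

/-! ### The exponential map of a Lie group -/

section LieExp

instance instFiniteDimensionalGroupLieAlgebra
    {E : Type*} [NormedAddCommGroup E] [NormedSpace ℝ E] [FiniteDimensional ℝ E]
    {G : Type*} [TopologicalSpace G] [ChartedSpace E G] [Group G] :
    FiniteDimensional ℝ (GroupLieAlgebra 𝓘(ℝ, E) G) :=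
  inferInstanceAs (FiniteDimensional ℝ E)

variable {E : Type*} [NormedAddCommGroup E] [NormedSpace ℝ E]
  {G : Type*} [TopologicalSpace G] [ChartedSpace E G] [Group G] [LieGroup 𝓘(ℝ, E) ∞ G]

/-- Left translates of (local) integral curves of a left-invariant vector field are integral
curves. -/
theorem isMIntegralCurveOn_mul_left {X : GroupLieAlgebra 𝓘(ℝ, E) G} {γ : ℝ → G} {s : Set ℝ}
    (h : IsMIntegralCurveOn γ (mulInvariantVectorField X) s) (g : G) :
    IsMIntegralCurveOn (fun t => g * γ t) (mulInvariantVectorField X) s := by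
  intro t ht
  have hd : ∀ a b : G, MDifferentiableAt 𝓘(ℝ, E) 𝓘(ℝ, E) (fun x : G => a * x) b := fun a b =>
    (contMDiff_mul_left (I := 𝓘(ℝ, E)) (n := ∞) (a := a)).mdifferentiableAt (by simp)
  have h1 := (hd g (γ t)).hasMFDerivAt.comp_hasMFDerivWithinAt t (h t ht)
  have h2 : mulInvariantVectorField X (g * γ t)
      = mfderiv 𝓘(ℝ, E) 𝓘(ℝ, E) (fun x : G => g * x) (γ t) (mulInvariantVectorField X (γ t)) := by
    have hc : (fun x : G => g * γ t * x) = (fun x => g * x) ∘ (fun x => γ t * x) := by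
      funext x
      simp [mul_assoc]
    have h3 := mfderiv_comp_of_eq (I := 𝓘(ℝ, E)) (I' := 𝓘(ℝ, E)) (I'' := 𝓘(ℝ, E))
      (x := (1 : G)) (hd g (γ t)) (hd (γ t) 1) (mul_one (γ t))
    rw [← hc] at h3
    have h5 : ∀ b : G, b = γ t →
        (mfderiv 𝓘(ℝ, E) 𝓘(ℝ, E) (fun x : G => g * x) b : E →L[ℝ] E)
          = mfderiv 𝓘(ℝ, E) 𝓘(ℝ, E) (fun x : G => g * x) (γ t) := by
      rintro _ rfl
      rfl
    exact (congrArg (fun f : E →L[ℝ] E => f X) h3).trans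
      (congrArg (fun f : E →L[ℝ] E => f (mulInvariantVectorField X (γ t)))
        (h5 _ (mul_one (γ t))))
  have h4 : (ContinuousLinearMap.smulRight (1 : ℝ →L[ℝ] ℝ) (mulInvariantVectorField X (g * γ t)) :
      ℝ →L[ℝ] E) = (mfderiv 𝓘(ℝ, E) 𝓘(ℝ, E) (fun x : G => g * x) (γ t) : E →L[ℝ] E).comp
        (ContinuousLinearMap.smulRight (1 : ℝ →L[ℝ] ℝ) (mulInvariantVectorField X (γ t) : E)) := by
    refine ContinuousLinearMap.ext fun r => ?_
    refine (congrArg (fun v : E => r • v) h2).trans ?_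
    exact (ContinuousLinearMap.map_smul
      (mfderiv 𝓘(ℝ, E) 𝓘(ℝ, E) (fun x : G => g * x) (γ t) : E →L[ℝ] E) r
      (mulInvariantVectorField X (γ t) : E)).symm
  show HasMFDerivWithinAt 𝓘(ℝ, ℝ) 𝓘(ℝ, E) (fun t => g * γ t) s t
    (ContinuousLinearMap.smulRight (1 : ℝ →L[ℝ] ℝ) (mulInvariantVectorField X (g * γ t)))
  exact h4 ▸ h1

variable [FiniteDimensional ℝ E] [T2Space G]

/-- Left-invariant vector fields on a Lie group are complete: each `X` in the Lie algebra
determines a one-parameter subgroup. -/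
theorem exists_oneParam (X : GroupLieAlgebra 𝓘(ℝ, E) G) :
    ∃ γ : ℝ → G, γ 0 = 1 ∧ IsMIntegralCurve γ (mulInvariantVectorField X) := by
  have hv : ContMDiff 𝓘(ℝ, E) 𝓘(ℝ, E).tangent 1
      (fun g : G => (⟨g, mulInvariantVectorField X g⟩ : TangentBundle 𝓘(ℝ, E) G)) :=
    (contMDiff_mulInvariantVectorField X).of_le (by
      rw [minSmoothness_of_isRCLikeNormedField]; norm_num)
  have : IsManifold 𝓘(ℝ, E) 1 G := inferInstance
  obtain ⟨γ, h0, hγ⟩ := exists_isMIntegralCurveAt_of_contMDiffAt_boundaryless (t₀ := 0)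
    (hv.contMDiffAt (x := 1))
  obtain ⟨ε, hε, hγ⟩ := isMIntegralCurveAt_iff'.1 hγ
  rw [Real.ball_eq_Ioo, zero_sub, zero_add] at hγ
  exact exists_isMIntegralCurve_of_isMIntegralCurveOn hv hε
    (fun g => ⟨fun t => g * γ t, by simp [h0], isMIntegralCurveOn_mul_left hγ g⟩) 1

/-- The exponential map of a Lie group: `lieExp X = γ 1`, where `γ` is the integral curve through
the identity of the left-invariant vector field determined by `X`. -/
def lieExp (X : GroupLieAlgebra 𝓘(ℝ, E) G) : G :=
  (exists_oneParam X).choose 1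

/-- `lieExp X` may be computed from any integral curve starting at the identity. -/
theorem lieExp_eq {X : GroupLieAlgebra 𝓘(ℝ, E) G} {γ : ℝ → G} (h0 : γ 0 = 1)
    (hγ : IsMIntegralCurve γ (mulInvariantVectorField X)) : lieExp X = γ 1 := by
  have hv : ContMDiff 𝓘(ℝ, E) 𝓘(ℝ, E).tangent 1
      (fun g : G => (⟨g, mulInvariantVectorField X g⟩ : TangentBundle 𝓘(ℝ, E) G)) :=
    (contMDiff_mulInvariantVectorField X).of_le (by
      rw [minSmoothness_of_isRCLikeNormedField]; norm_num)
  have : IsManifold 𝓘(ℝ, E) 1 G := inferInstance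
  have hs := (exists_oneParam X).choose_spec
  exact congrFun (isMIntegralCurve_Ioo_eq_of_contMDiff_boundaryless (t₀ := 0) hv hs.2 hγ
    (hs.1.trans h0.symm)) 1

end LieExp

/-! ### Cartan involutions, roots and normalized root vectors -/

section Algebra

variable {L : Type*} [LieRing L] [LieAlgebra ℝ L]

/-- `θ` is a Cartan involution of the real Lie algebra `L`: an involutive automorphism such that
`(x, y) ↦ -κ(x, θ y)` is positive definite, `κ` being the Killing form. -/
structure IsCartanInvolution (θ : L ≃ₗ⁅ℝ⁆ L) : Prop where
  involutive : ∀ x : L, θ (θ x) = x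
  pos : ∀ x : L, x ≠ 0 → 0 < -killingForm ℝ L x (θ x)

variable [FiniteDimensional ℝ L] [LieAlgebra.IsSemisimple ℝ L]
  {𝔞 : LieSubalgebra ℝ L} [𝔞.IsCartanSubalgebra]

/-- The squared length `⟨α, α⟩ = α(H_α)` of a weight, where `H_α ∈ 𝔞` is the vector with
`κ(H_α, h) = α(h)` for all `h ∈ 𝔞`. -/
def rootNormSq (α : LieModule.Weight ℝ 𝔞 L) : ℝ :=
  α ((LieAlgebra.IsKilling.cartanEquivDual 𝔞).symm (LieModule.Weight.toLinear ℝ 𝔞 L α))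

variable [LieModule.IsTriangularizable ℝ 𝔞 L]

/-- A choice of root vectors `X_γ ∈ L_γ`, one for each root `γ`, with `X_{-γ} = -θ X_γ` and
`κ(X_γ, X_{-γ}) = 2 / ⟨γ, γ⟩`. -/
structure IsNormalizedRootVectors (θ : L ≃ₗ⁅ℝ⁆ L) (X : LieModule.Weight ℝ 𝔞 L → L) : Prop where
  mem_rootSpace : ∀ γ : LieModule.Weight ℝ 𝔞 L, γ.IsNonZero → X γ ∈ LieAlgebra.rootSpace 𝔞 γ
  neg : ∀ γ : LieModule.Weight ℝ 𝔞 L, γ.IsNonZero → X (-γ) = -θ (X γ)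
  killingForm_neg : ∀ γ : LieModule.Weight ℝ 𝔞 L, γ.IsNonZero →
    killingForm ℝ L (X γ) (X (-γ)) = 2 / rootNormSq γ

/-- The roots `α` and `β` are joined by a double edge, i.e. the product of the two Cartan integers
`2⟨α, β⟩/⟨β, β⟩` and `2⟨β, α⟩/⟨α, α⟩` is `2`, and `α` is the shorter one. -/
structure IsDoubleEdgeShort (α β : 𝔞.root) : Prop where
  double : (LieAlgebra.IsKilling.rootSystem 𝔞).coxeterWeight α β = 2
  short : rootNormSq (α : LieModule.Weight ℝ 𝔞 L) < rootNormSq (β : LieModule.Weight ℝ 𝔞 L)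

end Algebra

/-! ### One-parameter rotations and representatives of simple reflections -/

section Rotations

variable {E : Type*} [NormedAddCommGroup E] [NormedSpace ℝ E] [FiniteDimensional ℝ E]
  {G : Type*} [TopologicalSpace G] [T2Space G] [ChartedSpace E G] [Group G]
  [LieGroup 𝓘(ℝ, E) ∞ G] [LieAlgebra.IsSemisimple ℝ (GroupLieAlgebra 𝓘(ℝ, E) G)]
  {𝔞 : LieSubalgebra ℝ (GroupLieAlgebra 𝓘(ℝ, E) G)} [𝔞.IsCartanSubalgebra]
  [LieModule.IsTriangularizable ℝ 𝔞 (GroupLieAlgebra 𝓘(ℝ, E) G)]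

/-- `A_γ = X_γ - X_{-γ}`. -/
def rotGen (X : LieModule.Weight ℝ 𝔞 (GroupLieAlgebra 𝓘(ℝ, E) G) → GroupLieAlgebra 𝓘(ℝ, E) G)
    (γ : 𝔞.root) : GroupLieAlgebra 𝓘(ℝ, E) G :=
  X γ - X (-(γ : LieModule.Weight ℝ 𝔞 (GroupLieAlgebra 𝓘(ℝ, E) G)))

/-- `expRot X γ t = exp (t A_γ)`. -/
def expRot (X : LieModule.Weight ℝ 𝔞 (GroupLieAlgebra 𝓘(ℝ, E) G) → GroupLieAlgebra 𝓘(ℝ, E) G)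
    (γ : 𝔞.root) (t : ℝ) : G :=
  lieExp (t • rotGen X γ)

/-- The representative `s_γ = exp ((π / 2) A_γ)` of the reflection in the root `γ`. -/
def reflRep (X : LieModule.Weight ℝ 𝔞 (GroupLieAlgebra 𝓘(ℝ, E) G) → GroupLieAlgebra 𝓘(ℝ, E) G)
    (γ : 𝔞.root) : G :=
  expRot X γ (Real.pi / 2)

end Rotations

end

section LieGroupBasics

variable {E : Type*} [NormedAddCommGroup E] [NormedSpace ℝ E]

/-- The chain rule for maps between manifolds modelled on normed spaces, with all derivatives
viewed as maps between the model spaces. -/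
theorem hasMFDerivAt_comp_of_eq {E₁ E₂ E₃ M₁ M₂ M₃ : Type*}
    [NormedAddCommGroup E₁] [NormedSpace ℝ E₁] [NormedAddCommGroup E₂] [NormedSpace ℝ E₂]
    [NormedAddCommGroup E₃] [NormedSpace ℝ E₃]
    [TopologicalSpace M₁] [ChartedSpace E₁ M₁] [TopologicalSpace M₂] [ChartedSpace E₂ M₂]
    [TopologicalSpace M₃] [ChartedSpace E₃ M₃] {g : M₂ → M₃} {f : M₁ → M₂} {x : M₁} {y : M₂}
    {g' : E₂ →L[ℝ] E₃} {f' : E₁ →L[ℝ] E₂}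
    (hg : HasMFDerivAt 𝓘(ℝ, E₂) 𝓘(ℝ, E₃) g y g') (hf : HasMFDerivAt 𝓘(ℝ, E₁) 𝓘(ℝ, E₂) f x f')
    (hy : f x = y) :
    HasMFDerivAt 𝓘(ℝ, E₁) 𝓘(ℝ, E₃) (fun z => g (f z)) x (g'.comp f') := by
  subst hy
  exact hg.comp x hf

/-- Uniqueness of the derivative, with derivatives viewed as maps between the model spaces. -/
theorem hasMFDerivAt_model_unique {E₁ E₂ M₁ M₂ : Type*}
    [NormedAddCommGroup E₁] [NormedSpace ℝ E₁] [NormedAddCommGroup E₂] [NormedSpace ℝ E₂]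
    [TopologicalSpace M₁] [ChartedSpace E₁ M₁] [TopologicalSpace M₂] [ChartedSpace E₂ M₂]
    {f g : M₁ → M₂} {x : M₁} {f' g' : E₁ →L[ℝ] E₂}
    (h : HasMFDerivAt 𝓘(ℝ, E₁) 𝓘(ℝ, E₂) f x f') (h' : HasMFDerivAt 𝓘(ℝ, E₁) 𝓘(ℝ, E₂) g x g')
    (hfg : ∀ y, f y = g y) : f' = g' := by
  obtain rfl : f = g := funext hfg
  exact hasMFDerivAt_unique h h'

/-- Replacing the derivative by an equal one, viewed as a map between the model spaces. -/
theorem hasMFDerivAt_model_congr {E₁ E₂ M₁ M₂ : Type*}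
    [NormedAddCommGroup E₁] [NormedSpace ℝ E₁] [NormedAddCommGroup E₂] [NormedSpace ℝ E₂]
    [TopologicalSpace M₁] [ChartedSpace E₁ M₁] [TopologicalSpace M₂] [ChartedSpace E₂ M₂]
    {f : M₁ → M₂} {x : M₁} {f' g' : E₁ →L[ℝ] E₂}
    (h : HasMFDerivAt 𝓘(ℝ, E₁) 𝓘(ℝ, E₂) f x f') (hfg : f' = g') :
    HasMFDerivAt 𝓘(ℝ, E₁) 𝓘(ℝ, E₂) f x g' := by
  subst hfg
  exact h

variable {G : Type*} [TopologicalSpace G] [ChartedSpace E G] [Group G]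

/-- The derivative of left translation by `g` at `h`, as a map of the model space. -/
noncomputable def leftTransDeriv (g h : G) : E →L[ℝ] E :=
  mfderiv 𝓘(ℝ, E) 𝓘(ℝ, E) (fun x : G => g * x) h

/-- The derivative of right translation by `g` at `h`, as a map of the model space. -/
noncomputable def rightTransDeriv (g h : G) : E →L[ℝ] E :=
  mfderiv 𝓘(ℝ, E) 𝓘(ℝ, E) (fun x : G => x * g) h

/-- The adjoint action of `g` on the tangent space at the identity. -/
noncomputable def groupAd (g : G) : E →L[ℝ] E :=
  mfderiv 𝓘(ℝ, E) 𝓘(ℝ, E) (fun x : G => g * x * g⁻¹) 1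

variable [LieGroup 𝓘(ℝ, E) ∞ G]

theorem hasMFDerivAt_mul_left_model (g h : G) :
    HasMFDerivAt 𝓘(ℝ, E) 𝓘(ℝ, E) (fun x : G => g * x) h (leftTransDeriv g h : E →L[ℝ] E) :=
  ((contMDiff_mul_left (I := 𝓘(ℝ, E)) (n := ∞) (a := g)).mdifferentiableAt (by simp)).hasMFDerivAt

theorem hasMFDerivAt_mul_right_model (g h : G) :
    HasMFDerivAt 𝓘(ℝ, E) 𝓘(ℝ, E) (fun x : G => x * g) h (rightTransDeriv g h : E →L[ℝ] E) :=
  ((contMDiff_mul_right (I := 𝓘(ℝ, E)) (n := ∞) (a := g)).mdifferentiableAt (by simp)).hasMFDerivAt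

theorem hasMFDerivAt_conj (g h : G) :
    HasMFDerivAt 𝓘(ℝ, E) 𝓘(ℝ, E) (fun x : G => g * x * g⁻¹) h
      ((rightTransDeriv g⁻¹ (g * h)).comp (leftTransDeriv g h) : E →L[ℝ] E) :=
  hasMFDerivAt_comp_of_eq (hasMFDerivAt_mul_right_model g⁻¹ (g * h))
    (hasMFDerivAt_mul_left_model g h) rfl

theorem hasMFDerivAt_conj_one (g : G) :
    HasMFDerivAt 𝓘(ℝ, E) 𝓘(ℝ, E) (fun x : G => g * x * g⁻¹) 1 (groupAd g : E →L[ℝ] E) :=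
  (hasMFDerivAt_conj g 1).mdifferentiableAt.hasMFDerivAt

theorem groupAd_mul (g h : G) :
    (groupAd (g * h) : E →L[ℝ] E) = (groupAd g).comp (groupAd h) := by
  refine hasMFDerivAt_model_unique (hasMFDerivAt_conj_one (g * h))
    (hasMFDerivAt_comp_of_eq (hasMFDerivAt_conj_one g) (hasMFDerivAt_conj_one h) (by simp))
    fun y => ?_
  group

theorem groupAd_one : (groupAd (1 : G) : E →L[ℝ] E) = ContinuousLinearMap.id ℝ E := by
  exact hasMFDerivAt_model_unique (hasMFDerivAt_conj_one 1) (hasMFDerivAt_id (1 : G)) (by simp)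

theorem rightTransDeriv_comp_groupAd (g : G) :
    (rightTransDeriv g (1 : G) : E →L[ℝ] E).comp (groupAd g) = leftTransDeriv g 1 := by
  refine hasMFDerivAt_model_unique (hasMFDerivAt_comp_of_eq (hasMFDerivAt_mul_right_model g 1)
    (hasMFDerivAt_conj_one g) (by simp)) (hasMFDerivAt_mul_left_model g 1) fun y => ?_
  group

theorem leftTransDeriv_conj (g h : G) :
    (leftTransDeriv (g * h * g⁻¹) (1 : G) : E →L[ℝ] E).comp (groupAd g) =
      ((rightTransDeriv g⁻¹ (g * h)).comp (leftTransDeriv g h)).comp (leftTransDeriv h 1) := by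
  refine hasMFDerivAt_model_unique (hasMFDerivAt_comp_of_eq
    (hasMFDerivAt_mul_left_model (E := E) (g * h * g⁻¹) 1) (hasMFDerivAt_conj_one g) (by simp))
    (hasMFDerivAt_comp_of_eq (hasMFDerivAt_conj g h) (hasMFDerivAt_mul_left_model h 1) (by simp))
    fun y => ?_
  group

/-- Conjugating an integral curve of a left-invariant vector field. -/
theorem isMIntegralCurve_conj {X : GroupLieAlgebra 𝓘(ℝ, E) G} {γ : ℝ → G}
    (h : IsMIntegralCurve γ (mulInvariantVectorField X)) (g : G) :
    IsMIntegralCurve (fun t => g * γ t * g⁻¹)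
      (mulInvariantVectorField (I := 𝓘(ℝ, E)) (G := G) (groupAd (E := E) g (X : E))) := by
  intro t
  let T : E →L[ℝ] E := (rightTransDeriv g⁻¹ (g * γ t)).comp (leftTransDeriv g (γ t))
  let v : E := leftTransDeriv (E := E) (γ t) (1 : G) (X : E)
  let w : E := leftTransDeriv (E := E) (g * γ t * g⁻¹) (1 : G) (groupAd (E := E) g (X : E))
  have h1 : HasMFDerivAt 𝓘(ℝ, ℝ) 𝓘(ℝ, E) (fun t => g * γ t * g⁻¹) t
      (T.comp (ContinuousLinearMap.smulRight (1 : ℝ →L[ℝ] ℝ) v)) :=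
    hasMFDerivAt_comp_of_eq (hasMFDerivAt_conj (E := E) g (γ t)) (h t) rfl
  have h2 : w = T v :=
    congrArg (fun f : E →L[ℝ] E => f (X : E)) (leftTransDeriv_conj (E := E) g (γ t))
  have h3 : T.comp (ContinuousLinearMap.smulRight (1 : ℝ →L[ℝ] ℝ) v) =
      ContinuousLinearMap.smulRight (1 : ℝ →L[ℝ] ℝ) w := by
    ext
    simp [h2]
  exact hasMFDerivAt_model_congr h1 h3

theorem contMDiff_one_mulInvariantVectorField (X : GroupLieAlgebra 𝓘(ℝ, E) G) :
    ContMDiff 𝓘(ℝ, E) 𝓘(ℝ, E).tangent 1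
      (fun g : G => (⟨g, mulInvariantVectorField X g⟩ : TangentBundle 𝓘(ℝ, E) G)) :=
  (contMDiff_mulInvariantVectorField X).of_le (by
    rw [minSmoothness_of_isRCLikeNormedField]; norm_num)

variable [FiniteDimensional ℝ E] [T2Space G]

theorem lieExp_smul_eq {X : GroupLieAlgebra 𝓘(ℝ, E) G} {γ : ℝ → G} (h0 : γ 0 = 1)
    (hγ : IsMIntegralCurve γ (mulInvariantVectorField X)) (t : ℝ) : lieExp (t • X) = γ t := by
  have h := hγ.comp_mul t
  rw [← mulInvariantVectorField_smul] at h
  have := lieExp_eq (by simp [h0]) h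
  simpa using this

theorem isMIntegralCurve_lieExp (X : GroupLieAlgebra 𝓘(ℝ, E) G) :
    IsMIntegralCurve (fun t : ℝ => (lieExp (t • X) : G)) (mulInvariantVectorField X) := by
  obtain ⟨γ, h0, hγ⟩ := exists_oneParam X
  have : (fun t : ℝ => (lieExp (t • X) : G)) = γ := funext fun t => lieExp_smul_eq h0 hγ t
  rwa [this]

theorem lieExp_zero_smul (X : GroupLieAlgebra 𝓘(ℝ, E) G) : (lieExp ((0 : ℝ) • X) : G) = 1 := by
  obtain ⟨γ, h0, hγ⟩ := exists_oneParam X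
  rw [lieExp_smul_eq h0 hγ, h0]

theorem lieExp_add_smul (X : GroupLieAlgebra 𝓘(ℝ, E) G) (s t : ℝ) :
    (lieExp ((s + t) • X) : G) = lieExp (s • X) * lieExp (t • X) := by
  have hX := isMIntegralCurve_lieExp X
  have : IsManifold 𝓘(ℝ, E) 1 G := inferInstance
  have h1 := hX.comp_add s
  have h2 : IsMIntegralCurve (fun t : ℝ => (lieExp (s • X) * lieExp (t • X) : G))
      (mulInvariantVectorField X) := by
    rw [isMIntegralCurve_iff_isMIntegralCurveOn] at hX ⊢
    exact isMIntegralCurveOn_mul_left hX _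
  have := congrFun (isMIntegralCurve_Ioo_eq_of_contMDiff_boundaryless (t₀ := 0)
    (contMDiff_one_mulInvariantVectorField X) h1 h2
    (by simp only [Function.comp_apply, zero_add, lieExp_zero_smul, mul_one])) t
  simpa [add_comm] using this

theorem lieExp_neg_smul (X : GroupLieAlgebra 𝓘(ℝ, E) G) (t : ℝ) :
    (lieExp ((-t) • X) : G) = (lieExp (t • X))⁻¹ := by
  rw [eq_inv_iff_mul_eq_one, ← lieExp_add_smul, neg_add_cancel, lieExp_zero_smul]

theorem conj_lieExp_smul (g : G) (X : GroupLieAlgebra 𝓘(ℝ, E) G) (t : ℝ) :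
    g * lieExp (t • X) * g⁻¹ =
      lieExp (E := E) (G := G) (t • groupAd (E := E) g (X : E)) :=
  (lieExp_smul_eq (γ := fun t => g * lieExp (t • X) * g⁻¹) (by rw [lieExp_zero_smul]; simp)
    (isMIntegralCurve_conj (isMIntegralCurve_lieExp X) g) t).symm

end LieGroupBasics

section ChartMul

open Filter Topology

variable {E : Type*} [NormedAddCommGroup E] [NormedSpace ℝ E]
  (G : Type*) [TopologicalSpace G] [ChartedSpace E G] [Group G]

/-- The multiplication of `G` read in the preferred chart at the identity. -/
noncomputable def chartMul (p : E × E) : E :=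
  extChartAt 𝓘(ℝ, E) (1 : G)
    ((extChartAt 𝓘(ℝ, E) (1 : G)).symm p.1 * (extChartAt 𝓘(ℝ, E) (1 : G)).symm p.2)

/-- The coordinates of the identity in the preferred chart. -/
noncomputable def chartOne : E := extChartAt 𝓘(ℝ, E) (1 : G) 1

theorem chartOne_symm : (extChartAt 𝓘(ℝ, E) (1 : G)).symm (chartOne G) = 1 :=
  extChartAt_to_inv (1 : G)

theorem chartOne_mem_target : (chartOne G : E) ∈ (extChartAt 𝓘(ℝ, E) (1 : G)).target :=
  mem_extChartAt_target (1 : G)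

theorem eventually_mem_target_chartOne :
    ∀ᶠ x in 𝓝 (chartOne G : E), x ∈ (extChartAt 𝓘(ℝ, E) (1 : G)).target :=
  extChartAt_target_mem_nhds (1 : G)

variable [LieGroup 𝓘(ℝ, E) ∞ G]

theorem contDiffAt_chartMul :
    ContDiffAt ℝ 2 (chartMul G) ((chartOne G, chartOne G) : E × E) := by
  have hm : IsManifold 𝓘(ℝ, E) 2 G := IsManifold.of_le (n := ∞) ENat.LEInfty.out
  rw [← contMDiffAt_iff_contDiffAt]
  have hs : ContMDiffAt 𝓘(ℝ, E) 𝓘(ℝ, E) 2 (extChartAt 𝓘(ℝ, E) (1 : G)).symm (chartOne G) :=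
    (contMDiffOn_extChartAt_symm (1 : G)).contMDiffAt (extChartAt_target_mem_nhds (1 : G))
  have h1 : ContMDiffAt 𝓘(ℝ, E × E) 𝓘(ℝ, E) 2
      (fun p : E × E => (extChartAt 𝓘(ℝ, E) (1 : G)).symm p.1) (chartOne G, chartOne G) :=
    ContMDiffAt.comp _ hs contDiff_fst.contMDiff.contMDiffAt
  have h2 : ContMDiffAt 𝓘(ℝ, E × E) 𝓘(ℝ, E) 2
      (fun p : E × E => (extChartAt 𝓘(ℝ, E) (1 : G)).symm p.2) (chartOne G, chartOne G) :=
    ContMDiffAt.comp _ hs contDiff_snd.contMDiff.contMDiffAt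
  have hL : LieGroup 𝓘(ℝ, E) 2 G := LieGroup.of_le (n := ∞) ENat.LEInfty.out
  have h3 := h1.mul h2
  have h4 : ContMDiffAt 𝓘(ℝ, E) 𝓘(ℝ, E) 2 (extChartAt 𝓘(ℝ, E) (1 : G))
      ((extChartAt 𝓘(ℝ, E) (1 : G)).symm (chartOne G : E) *
        (extChartAt 𝓘(ℝ, E) (1 : G)).symm (chartOne G : E)) := by
    rw [chartOne_symm, one_mul]
    exact contMDiffAt_extChartAt
  exact ContMDiffAt.comp (g := extChartAt 𝓘(ℝ, E) (1 : G)) _ h4 h3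

theorem hasMFDerivAt_extChartAt_symm_chartOne :
    HasMFDerivAt 𝓘(ℝ, E) 𝓘(ℝ, E) (extChartAt 𝓘(ℝ, E) (1 : G)).symm (chartOne G : E)
      (ContinuousLinearMap.id ℝ E : E →L[ℝ] E) := by
  have h1 := mdifferentiableWithinAt_extChartAt_symm (I := 𝓘(ℝ, E)) (chartOne_mem_target (E := E) G)
  have h2 := h1.hasMFDerivWithinAt
  have h3 := mfderivWithin_range_extChartAt_symm (I := 𝓘(ℝ, E)) (x := (1 : G))
  rw [ModelWithCorners.Boundaryless.range_eq_univ] at h2 h3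
  rw [hasMFDerivWithinAt_univ] at h2
  have h4 : (mfderivWithin 𝓘(ℝ, E) 𝓘(ℝ, E) (extChartAt 𝓘(ℝ, E) (1 : G)).symm Set.univ
    (chartOne G : E) : E →L[ℝ] E) = ContinuousLinearMap.id ℝ E := h3
  exact h4 ▸ h2

/-- The derivative of the preferred chart at the identity, as a map of the model space. -/
noncomputable def chartDeriv (g : G) : E →L[ℝ] E :=
  mfderiv 𝓘(ℝ, E) 𝓘(ℝ, E) (extChartAt 𝓘(ℝ, E) (1 : G)) g

theorem hasMFDerivAt_extChartAt_one {x : E} (hx : x ∈ (extChartAt 𝓘(ℝ, E) (1 : G)).target) :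
    HasMFDerivAt 𝓘(ℝ, E) 𝓘(ℝ, E) (extChartAt 𝓘(ℝ, E) (1 : G))
      ((extChartAt 𝓘(ℝ, E) (1 : G)).symm x)
      (chartDeriv G ((extChartAt 𝓘(ℝ, E) (1 : G)).symm x) : E →L[ℝ] E) :=
  (mdifferentiableAt_extChartAt (by
    rw [← extChartAt_source 𝓘(ℝ, E)]; exact PartialEquiv.map_target _ hx)).hasMFDerivAt

theorem eventually_differentiableAt_chartMul :
    ∀ᶠ p in 𝓝 ((chartOne G, chartOne G) : E × E), DifferentiableAt ℝ (chartMul G) p :=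
  ((contDiffAt_chartMul G).eventually (by simp)).mono fun _ h => h.differentiableAt (by simp)

theorem eventually_fderiv_chartMul_inr :
    ∀ᶠ x in 𝓝 (chartOne G : E), ∀ v : E, fderiv ℝ (chartMul G) (x, (chartOne G : E)) (0, v) =
      chartDeriv G ((extChartAt 𝓘(ℝ, E) (1 : G)).symm x)
        (leftTransDeriv (E := E) ((extChartAt 𝓘(ℝ, E) (1 : G)).symm x) (1 : G) v) := by
  have hc : Tendsto (fun x : E => (x, (chartOne G : E))) (𝓝 (chartOne G))
      (𝓝 (chartOne G, chartOne G)) := by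
    exact (Continuous.prodMk_left _).tendsto _
  filter_upwards [eventually_mem_target_chartOne G, hc.eventually
    (eventually_differentiableAt_chartMul G)] with x hx hd v
  have h1 := hasMFDerivAt_comp_of_eq (hasMFDerivAt_extChartAt_one G hx)
    (hasMFDerivAt_comp_of_eq (hasMFDerivAt_mul_left_model (E := E) _ 1)
      (hasMFDerivAt_extChartAt_symm_chartOne G) (chartOne_symm G))
    (by rw [chartOne_symm, mul_one])
  have h2 := hd.hasFDerivAt.comp (chartOne G) (hasFDerivAt_prodMk_right x (chartOne G))
  have h3 := hasMFDerivAt_model_unique h2.hasMFDerivAt h1 (fun _ => rfl)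
  exact congrArg (fun f : E →L[ℝ] E => f v) h3

theorem eventually_fderiv_chartMul_inl :
    ∀ᶠ x in 𝓝 (chartOne G : E), ∀ v : E, fderiv ℝ (chartMul G) ((chartOne G : E), x) (v, 0) =
      chartDeriv G ((extChartAt 𝓘(ℝ, E) (1 : G)).symm x)
        (rightTransDeriv (E := E) ((extChartAt 𝓘(ℝ, E) (1 : G)).symm x) (1 : G) v) := by
  have hc : Tendsto (fun x : E => ((chartOne G : E), x)) (𝓝 (chartOne G))
      (𝓝 (chartOne G, chartOne G)) := by
    exact (Continuous.prodMk_right _).tendsto _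
  filter_upwards [eventually_mem_target_chartOne G, hc.eventually
    (eventually_differentiableAt_chartMul G)] with x hx hd v
  have h1 := hasMFDerivAt_comp_of_eq (hasMFDerivAt_extChartAt_one G hx)
    (hasMFDerivAt_comp_of_eq (hasMFDerivAt_mul_right_model (E := E) _ 1)
      (hasMFDerivAt_extChartAt_symm_chartOne G) (chartOne_symm G))
    (by rw [chartOne_symm, one_mul])
  have h2 := HasFDerivAt.comp (f := fun y : E => (y, x)) (chartOne G) hd.hasFDerivAt
    (hasFDerivAt_prodMk_left (𝕜 := ℝ) (chartOne G) x)
  have h3 := hasMFDerivAt_model_unique h2.hasMFDerivAt h1 (fun _ => rfl)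
  exact congrArg (fun f : E →L[ℝ] E => f v) h3

theorem mpullbackWithin_extChartAt_symm_apply (V : Π g : G, TangentSpace 𝓘(ℝ, E) g) {x : E}
    (hx : x ∈ (extChartAt 𝓘(ℝ, E) (1 : G)).target) :
    (VectorField.mpullbackWithin 𝓘(ℝ, E) 𝓘(ℝ, E) (extChartAt 𝓘(ℝ, E) (1 : G)).symm V
      (Set.range 𝓘(ℝ, E)) x : E) = chartDeriv (E := E) G ((extChartAt 𝓘(ℝ, E) (1 : G)).symm x)
        (V ((extChartAt 𝓘(ℝ, E) (1 : G)).symm x) : E) := by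
  have : IsManifold 𝓘(ℝ, E) 1 G := inferInstance
  let v : E := V ((extChartAt 𝓘(ℝ, E) (1 : G)).symm x)
  exact congrArg (fun f : E →L[ℝ] E => f v)
    (ContinuousLinearMap.inverse_eq
      (mfderivWithin_extChartAt_symm_comp_mfderiv_extChartAt hx)
      (mfderiv_extChartAt_comp_mfderivWithin_extChartAt_symm hx))

/-- The left-invariant vector field of `v`, read in the chart at the identity. -/
noncomputable def chartInvField (v : E) : E → E :=
  VectorField.mpullbackWithin 𝓘(ℝ, E) 𝓘(ℝ, E) (extChartAt 𝓘(ℝ, E) (1 : G)).symm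
    (mulInvariantVectorField (I := 𝓘(ℝ, E)) (G := G) v) (Set.range 𝓘(ℝ, E))

theorem chartInvField_eventuallyEq (v : E) :
    chartInvField G v =ᶠ[𝓝 (chartOne G : E)]
      fun x => fderiv ℝ (chartMul G) (x, (chartOne G : E)) (0, v) := by
  filter_upwards [eventually_mem_target_chartOne G, eventually_fderiv_chartMul_inr G] with x hx h
  rw [h]
  exact mpullbackWithin_extChartAt_symm_apply G _ hx

/-- The mixed second derivative at the identity of the multiplication in the chart. -/
noncomputable def chartMulSnd : E × E →L[ℝ] E × E →L[ℝ] E :=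
  fderiv ℝ (fderiv ℝ (chartMul G)) ((chartOne G, chartOne G) : E × E)

theorem hasFDerivAt_fderiv_chartMul :
    HasFDerivAt (fderiv ℝ (chartMul G)) (chartMulSnd G) ((chartOne G, chartOne G) : E × E) :=
  (((contDiffAt_chartMul G).fderiv_right (m := 1) (by norm_num)).differentiableAt
    (by simp)).hasFDerivAt

theorem chartMulSnd_symm (u v : E × E) : chartMulSnd G u v = chartMulSnd G v u :=
  (contDiffAt_chartMul G).isSymmSndFDerivAt (by simp) u v

theorem fderiv_chartMul_chartOne_inr (v : E) :
    fderiv ℝ (chartMul G) ((chartOne G, chartOne G) : E × E) (0, v) = v := by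
  have hd := (eventually_differentiableAt_chartMul (E := E) G).self_of_nhds
  have h2 := hd.hasFDerivAt.comp (chartOne G)
    (hasFDerivAt_prodMk_right (𝕜 := ℝ) (chartOne G) (chartOne G))
  have h3 : HasFDerivAt (chartMul G ∘ fun y : E => (chartOne G, y)) (ContinuousLinearMap.id ℝ E)
      (chartOne G) := by
    refine (hasFDerivAt_id _).congr_of_eventuallyEq ?_
    filter_upwards [eventually_mem_target_chartOne (E := E) G] with x hx
    simp only [Function.comp_apply, chartMul, chartOne_symm, one_mul, id]
    exact PartialEquiv.right_inv _ hx
  exact congrArg (fun f : E →L[ℝ] E => f v) (h2.unique h3)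

theorem fderiv_chartMul_chartOne_inl (v : E) :
    fderiv ℝ (chartMul G) ((chartOne G, chartOne G) : E × E) (v, 0) = v := by
  have hd := (eventually_differentiableAt_chartMul (E := E) G).self_of_nhds
  have h2 := HasFDerivAt.comp (f := fun y : E => (y, (chartOne G : E))) (chartOne G) hd.hasFDerivAt
    (hasFDerivAt_prodMk_left (𝕜 := ℝ) (chartOne G) (chartOne G))
  have h3 : HasFDerivAt (chartMul G ∘ fun y : E => (y, chartOne G)) (ContinuousLinearMap.id ℝ E)
      (chartOne G) := by
    refine (hasFDerivAt_id _).congr_of_eventuallyEq ?_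
    filter_upwards [eventually_mem_target_chartOne (E := E) G] with x hx
    simp only [Function.comp_apply, chartMul, chartOne_symm, mul_one, id]
    exact PartialEquiv.right_inv _ hx
  exact congrArg (fun f : E →L[ℝ] E => f v) (h2.unique h3)

theorem hasFDerivAt_chartInvField (v : E) :
    HasFDerivAt (chartInvField G v)
      (((ContinuousLinearMap.apply ℝ E ((0, v) : E × E)).comp (chartMulSnd G)).comp
        (ContinuousLinearMap.inl ℝ E E)) (chartOne G) := by
  refine HasFDerivAt.congr_of_eventuallyEq ?_ (chartInvField_eventuallyEq G v)
  have h1 := HasFDerivAt.comp (f := fun y : E => (y, (chartOne G : E))) (chartOne G)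
    (hasFDerivAt_fderiv_chartMul (E := E) G)
    (hasFDerivAt_prodMk_left (𝕜 := ℝ) (chartOne G) (chartOne G))
  exact (ContinuousLinearMap.apply ℝ E ((0, v) : E × E)).hasFDerivAt.comp (chartOne G) h1

theorem chartInvField_chartOne (v : E) : chartInvField G v (chartOne G) = v :=
  (chartInvField_eventuallyEq G v).self_of_nhds.trans (fderiv_chartMul_chartOne_inr G v)

/-- The bracket of the Lie algebra of `G`, as a bilinear operation on the model space. -/
noncomputable def modelBracket (u v : E) : E :=
  VectorField.mlieBracket 𝓘(ℝ, E) (mulInvariantVectorField (I := 𝓘(ℝ, E)) (G := G) u)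
    (mulInvariantVectorField (I := 𝓘(ℝ, E)) (G := G) v) 1

theorem modelBracket_eq_chartMulSnd (u v : E) :
    modelBracket G u v = chartMulSnd G (u, 0) (0, v) - chartMulSnd G (v, 0) (0, u) := by
  have : IsManifold 𝓘(ℝ, E) 1 G := inferInstance
  let D : E →L[ℝ] E := mfderiv 𝓘(ℝ, E) 𝓘(ℝ, E) (extChartAt 𝓘(ℝ, E) (1 : G)) 1
  have hD : D = ContinuousLinearMap.id ℝ E := mfderiv_extChartAt_self
  have h : modelBracket G u v = ContinuousLinearMap.inverse D
      (VectorField.lieBracketWithin ℝ (chartInvField G u) (chartInvField G v)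
        ((extChartAt 𝓘(ℝ, E) (1 : G)).symm ⁻¹' Set.univ ∩ Set.range 𝓘(ℝ, E)) (chartOne G)) :=
    VectorField.mlieBracketWithin_apply
  rw [h, hD, ContinuousLinearMap.inverse_id, Set.preimage_univ, Set.univ_inter,
    ModelWithCorners.Boundaryless.range_eq_univ,
    VectorField.lieBracketWithin_univ, VectorField.lieBracket, chartInvField_chartOne,
    chartInvField_chartOne, (hasFDerivAt_chartInvField G u).fderiv,
    (hasFDerivAt_chartInvField G v).fderiv]
  simp

end ChartMul

section AdjointDerivative

open Filter Topology

theorem hasDerivAt_of_clm_apply_eq {E : Type*} [NormedAddCommGroup E] [NormedSpace ℝ E]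
    [CompleteSpace E] {T : ℝ → E →L[ℝ] E} {a b : ℝ → E} {T' : E →L[ℝ] E} {b' : E} {t : ℝ}
    (hT : HasDerivAt T T' t) (hTt : T t = ContinuousLinearMap.id ℝ E) (hb : HasDerivAt b b' t)
    (hab : ∀ᶠ s in 𝓝 t, T s (a s) = b s) : HasDerivAt a (b' - T' (a t)) t := by
  have hTt' : T t = ((1 : (E →L[ℝ] E)ˣ) : E →L[ℝ] E) := hTt
  have hu : ∀ᶠ s in 𝓝 t, IsUnit (T s) := by
    have h1 : ∀ᶠ S in 𝓝 (T t), IsUnit S := hTt' ▸ Units.nhds 1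
    exact hT.continuousAt.eventually h1
  have hinv : HasDerivAt (fun s => Ring.inverse (T s)) (-T') t := by
    have h1 := hasFDerivAt_ringInverse (𝕜 := ℝ) (1 : (E →L[ℝ] E)ˣ)
    rw [← hTt'] at h1
    have h2 : HasDerivAt (fun s => Ring.inverse (T s)) _ t := h1.comp_hasDerivAt t hT
    convert h2 using 1
    simp
  have h3 := hinv.clm_apply hb
  have h4 : a t = b t := by
    have := hab.self_of_nhds
    rwa [hTt] at this
  have h5 : HasDerivAt (fun s => Ring.inverse (T s) (b s)) (b' - T' (a t)) t := by
    convert h3 using 1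
    rw [hTt', Ring.inverse_unit, h4]
    simp [neg_add_eq_sub]
  refine h5.congr_of_eventuallyEq ?_
  filter_upwards [hab, hu] with s hs hus
  rw [← hs]
  exact (congrArg (fun S : E →L[ℝ] E => S (a s)) (Ring.inverse_mul_cancel (T s) hus)).symm

variable {E : Type*} [NormedAddCommGroup E] [NormedSpace ℝ E]
  {G : Type*} [TopologicalSpace G] [ChartedSpace E G] [Group G]

/-- The adjoint action of a Lie group on its Lie algebra. -/
noncomputable def lieAd (g : G) (X : GroupLieAlgebra 𝓘(ℝ, E) G) : GroupLieAlgebra 𝓘(ℝ, E) G :=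
  groupAd (E := E) g (X : E)

theorem lieAd_add (g : G) (X Y : GroupLieAlgebra 𝓘(ℝ, E) G) :
    lieAd g (X + Y) = lieAd g X + lieAd g Y :=
  (groupAd (E := E) g).map_add (X : E) (Y : E)

theorem lieAd_smul (g : G) (c : ℝ) (X : GroupLieAlgebra 𝓘(ℝ, E) G) :
    lieAd g (c • X) = c • lieAd g X :=
  (groupAd (E := E) g).map_smul c (X : E)

variable [LieGroup 𝓘(ℝ, E) ∞ G]

/-- The derivative at the identity of the adjoint representation is the Lie bracket. -/
theorem hasDerivAt_groupAd [CompleteSpace E] {γ : ℝ → G} (h0 : γ 0 = 1) {u : E}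
    (hγ : HasMFDerivAt 𝓘(ℝ, ℝ) 𝓘(ℝ, E) γ 0
      (ContinuousLinearMap.smulRight (1 : ℝ →L[ℝ] ℝ) u : ℝ →L[ℝ] E)) (v : E) :
    HasDerivAt (fun t => groupAd (γ t) v) (modelBracket G u v) 0 := by
  have : IsManifold 𝓘(ℝ, E) 1 G := inferInstance
  let x : ℝ → E := fun t => extChartAt 𝓘(ℝ, E) (1 : G) (γ t)
  have hx0 : x 0 = chartOne G := by simp only [x, h0]; rfl
  have hx : HasDerivAt x u 0 := by
    have h1 := hasMFDerivAt_extChartAt_one G (chartOne_mem_target (E := E) G)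
    rw [chartOne_symm] at h1
    have h2 : chartDeriv (E := E) G 1 = ContinuousLinearMap.id ℝ E := mfderiv_extChartAt_self
    rw [h2] at h1
    have h3 : HasFDerivAt x ((ContinuousLinearMap.id ℝ E).comp
        (ContinuousLinearMap.smulRight (1 : ℝ →L[ℝ] ℝ) u)) 0 :=
      hasMFDerivAt_iff_hasFDerivAt.1 (hasMFDerivAt_comp_of_eq h1 hγ h0)
    simpa using h3.hasDerivAt
  have hxt : Tendsto x (𝓝 0) (𝓝 (chartOne G)) := hx0 ▸ hx.continuousAt
  have hS := hasFDerivAt_fderiv_chartMul (E := E) G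
  have hl : HasDerivAt (fun t => ((chartOne G : E), x t)) ((0 : E), u) 0 :=
    (hasDerivAt_const _ _).prodMk hx
  have hr : HasDerivAt (fun t => (x t, (chartOne G : E))) (u, (0 : E)) 0 :=
    hx.prodMk (hasDerivAt_const _ _)
  have hT := (HasFDerivAt.comp_hasDerivAt_of_eq (0 : ℝ) hS hl (by rw [hx0])).clm_comp
    (hasDerivAt_const (0 : ℝ) (ContinuousLinearMap.inl ℝ E E))
  have hb := (HasFDerivAt.comp_hasDerivAt_of_eq (0 : ℝ) hS hr (by rw [hx0])).clm_apply
    (hasDerivAt_const (0 : ℝ) ((0 : E), v))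
  have key := hasDerivAt_of_clm_apply_eq (a := fun t => groupAd (γ t) v) hT ?_ hb ?_
  · convert key using 1
    rw [h0, groupAd_one, modelBracket_eq_chartMulSnd]
    simp [chartMulSnd_symm G (0, u)]
  · ext w
    simp [hx0, fderiv_chartMul_chartOne_inl]
  · have hsrc : ∀ᶠ t in 𝓝 (0 : ℝ), γ t ∈ (extChartAt 𝓘(ℝ, E) (1 : G)).source := by
      refine hγ.continuousAt.eventually ?_
      rw [h0]
      exact extChartAt_source_mem_nhds (1 : G)
    filter_upwards [hsrc, hxt.eventually (eventually_fderiv_chartMul_inl G),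
      hxt.eventually (eventually_fderiv_chartMul_inr G)] with t ht h1 h2
    have h3 : (extChartAt 𝓘(ℝ, E) (1 : G)).symm (x t) = γ t := PartialEquiv.left_inv _ ht
    rw [h3] at h1 h2
    have h4 := congrArg (fun f : E →L[ℝ] E => f v) (rightTransDeriv_comp_groupAd (E := E) (γ t))
    simp only [Function.comp_apply, ContinuousLinearMap.comp_apply,
      ContinuousLinearMap.inl_apply] at h4 ⊢
    rw [h1, h2, h4]

/-- The bracket with a fixed element, as a continuous linear map of the model space. -/
theorem exists_clm_modelBracket (u : E) :
    ∃ K : E →L[ℝ] E, ∀ v, K v = modelBracket G u v :=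
  ⟨(chartMulSnd G (u, 0)).comp (ContinuousLinearMap.inr ℝ E E) -
    ((ContinuousLinearMap.apply ℝ E ((0, u) : E × E)).comp (chartMulSnd G)).comp
      (ContinuousLinearMap.inl ℝ E E), fun v => by simp [modelBracket_eq_chartMulSnd]⟩

variable [FiniteDimensional ℝ E] [T2Space G]

theorem hasDerivAt_groupAd_lieExp (X : GroupLieAlgebra 𝓘(ℝ, E) G) (v : E) (t : ℝ) :
    HasDerivAt (fun s : ℝ => groupAd (lieExp (s • X) : G) v)
      (modelBracket G X (groupAd (lieExp (t • X) : G) v)) t := by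
  have : CompleteSpace E := FiniteDimensional.complete ℝ E
  let u : E := X
  have h1 : HasMFDerivAt 𝓘(ℝ, ℝ) 𝓘(ℝ, E) (fun s : ℝ => (lieExp (s • X) : G)) 0
      (ContinuousLinearMap.smulRight (1 : ℝ →L[ℝ] ℝ) u : ℝ →L[ℝ] E) := by
    have h2 := isMIntegralCurve_lieExp X 0
    have h3 : leftTransDeriv (E := E) (lieExp ((0 : ℝ) • X) : G) (1 : G) u = u := by
      rw [lieExp_zero_smul]
      refine congrArg (fun f : E →L[ℝ] E => f u) (hasMFDerivAt_model_unique
        (g' := ContinuousLinearMap.id ℝ E)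
        (hasMFDerivAt_mul_left_model (E := E) (1 : G) 1) (hasMFDerivAt_id (1 : G)) (by simp))
    exact hasMFDerivAt_model_congr h2
      (congrArg (fun w : E => (ContinuousLinearMap.smulRight (1 : ℝ →L[ℝ] ℝ) w : ℝ →L[ℝ] E)) h3)
  have h2 := hasDerivAt_groupAd (lieExp_zero_smul X) h1 (groupAd (lieExp (t • X) : G) v)
  have h3 : HasDerivAt (fun s : ℝ => s - t) 1 t := (hasDerivAt_id t).sub_const t
  have h4 := HasDerivAt.scomp_of_eq t h2 h3 (by simp)
  rw [one_smul] at h4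
  convert h4 using 1
  funext s
  have h5 : (lieExp (s • X) : G) = lieExp ((s - t) • X) * lieExp (t • X) := by
    rw [← lieExp_add_smul, sub_add_cancel]
  rw [h5, groupAd_mul]
  rfl

/-- A solution of `f' = [X, f]` is transported by the adjoint action of `exp (t X)`. -/
theorem groupAd_lieExp_eq_of_hasDerivAt {X : GroupLieAlgebra 𝓘(ℝ, E) G} {f : ℝ → E}
    (hf : ∀ t, HasDerivAt f (modelBracket G X (f t)) t) (t : ℝ) :
    groupAd (lieExp (t • X) : G) (f 0) = f t := by
  obtain ⟨K, hK⟩ := exists_clm_modelBracket (E := E) (G := G) X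
  have h := ODE_solution_unique_univ (v := fun _ => K) (s := fun _ => Set.univ) (t₀ := 0)
    (f := fun s : ℝ => groupAd (lieExp (s • X) : G) (f 0)) (g := f) (K := ‖K‖₊)
    (fun _ => K.lipschitz.lipschitzOnWith)
    (fun s => ⟨by rw [hK]; exact hasDerivAt_groupAd_lieExp X (f 0) s, trivial⟩)
    (fun s => ⟨by rw [hK]; exact hf s, trivial⟩)
    (by simp only [lieExp_zero_smul, groupAd_one]; rfl)
  exact congrFun h t

theorem conj_lieExp_smul_eq (g : G) (X : GroupLieAlgebra 𝓘(ℝ, E) G) (t : ℝ) :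
    g * lieExp (t • X) * g⁻¹ = lieExp (t • lieAd g X) :=
  conj_lieExp_smul g X t

theorem lieAd_lieExp_of_lie_eq_zero {A V : GroupLieAlgebra 𝓘(ℝ, E) G} (h : ⁅A, V⁆ = 0) (t : ℝ) :
    lieAd (lieExp (t • A)) V = V := by
  let v : E := V
  have h' : modelBracket (E := E) G A v = 0 := h
  refine groupAd_lieExp_eq_of_hasDerivAt (X := A) (f := fun _ => v) (fun s => ?_) t
  rw [h']
  exact hasDerivAt_const s v

/-- The adjoint action of `exp (t A)` on a plane on which `ad A` acts as an infinitesimal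
rotation. -/
theorem lieAd_lieExp_of_rotation {A V W : GroupLieAlgebra 𝓘(ℝ, E) G} {c : ℝ} (hc : c ≠ 0)
    (hV : ⁅A, V⁆ = W) (hW : ⁅A, W⁆ = -(c ^ 2 • V)) (t : ℝ) :
    lieAd (lieExp (t • A)) V = Real.cos (c * t) • V + (Real.sin (c * t) / c) • W := by
  let v : E := V
  let w : E := W
  obtain ⟨K, hK⟩ := exists_clm_modelBracket (E := E) (G := G) A
  have hv : K v = w := (hK v).trans hV
  have hw : K w = -(c ^ 2 • v) := (hK w).trans hW
  have hf : ∀ s : ℝ, HasDerivAt (fun s : ℝ => Real.cos (c * s) • v + (Real.sin (c * s) / c) • w)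
      (K (Real.cos (c * s) • v + (Real.sin (c * s) / c) • w)) s := by
    intro s
    have hm : HasDerivAt (fun s : ℝ => c * s) c s := by
      simpa using (hasDerivAt_id s).const_mul c
    have h1 := hm.cos.smul_const v
    have h2 := (hm.sin.div_const c).smul_const w
    refine (h1.add h2).congr_deriv ?_
    rw [map_add, map_smul, map_smul, hv, hw, smul_neg, smul_smul, add_comm, mul_div_assoc,
      div_self hc, mul_one, neg_mul, neg_smul]
    congr 3
    field_simp
  have h := groupAd_lieExp_eq_of_hasDerivAt (X := A) (fun s => hK _ ▸ hf s) t
  simp only [mul_zero, Real.cos_zero, Real.sin_zero, zero_div, one_smul, zero_smul,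
    add_zero] at h
  exact h

end AdjointDerivative

section Sl2

variable {L : Type*} [LieRing L] [LieAlgebra ℝ L]

theorem IsSl2Triple.lie_e_pow_eq_zero_of_lowest [FiniteDimensional ℝ L] {h e f v : L}
    (t : IsSl2Triple h e f) {n : ℕ} (hf : ⁅f, v⁆ = 0) (hh : ⁅h, v⁆ = -((n : ℝ) • v)) :
    (LieModule.toEnd ℝ L L e ^ (n + 1)) v = 0 := by
  by_cases hv : v = 0
  · simp [hv]
  · have P : t.symm.HasPrimitiveVectorWith v (n : ℝ) := ⟨hv, by rw [neg_lie, hh, neg_neg], hf⟩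
    exact P.pow_toEnd_f_eq_zero_of_eq_nat rfl

theorem IsSl2Triple.lie_sub_lie_sub_of_weight_one [FiniteDimensional ℝ L] {h e f v : L}
    (t : IsSl2Triple h e f) (hf : ⁅f, v⁆ = 0) (hh : ⁅h, v⁆ = -v) :
    ⁅e - f, ⁅e - f, v⁆⁆ = -v := by
  have h1 := t.lie_e_pow_eq_zero_of_lowest (n := 1) hf (by simpa using hh)
  have h2 : ⁅e, ⁅e, v⁆⁆ = 0 := by simpa [pow_succ] using h1
  have h3 : ⁅f, ⁅e, v⁆⁆ = v := by
    rw [leibniz_lie, hf, ← lie_skew f e, t.lie_e_f]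
    simp [hh]
  simp [sub_lie, hf, h2, h3]

theorem IsSl2Triple.lie_sub_pow_three_of_weight_two [FiniteDimensional ℝ L] {h e f v : L}
    (t : IsSl2Triple h e f) (hf : ⁅f, v⁆ = 0) (hh : ⁅h, v⁆ = -((2 : ℝ) • v)) :
    ⁅e - f, ⁅e - f, ⁅e - f, v⁆⁆⁆ = -((4 : ℝ) • ⁅e - f, v⁆) := by
  have h1 := t.lie_e_pow_eq_zero_of_lowest (n := 2) hf (by simpa using hh)
  have h2 : ⁅e, ⁅e, ⁅e, v⁆⁆⁆ = 0 := by simpa [pow_succ] using h1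
  have h3 : ⁅f, ⁅e, v⁆⁆ = (2 : ℝ) • v := by
    rw [leibniz_lie, hf, ← lie_skew f e, t.lie_e_f]
    simp [hh]
  have h4 : ⁅h, ⁅e, v⁆⁆ = 0 := by
    rw [leibniz_lie, t.lie_h_e_smul ℝ, hh]
    simp
  have h5 : ⁅f, ⁅e, ⁅e, v⁆⁆⁆ = (2 : ℝ) • ⁅e, v⁆ := by
    rw [leibniz_lie, h3, ← lie_skew f e, t.lie_e_f, neg_lie, h4]
    simp
  simp only [sub_lie, lie_sub, hf, h2, h3, h5, lie_smul, sub_zero, zero_sub]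
  module

end Sl2

section RootVectors

open LieAlgebra LieAlgebra.IsKilling LieModule

variable {L : Type*} [LieRing L] [LieAlgebra ℝ L] [FiniteDimensional ℝ L]
  [LieAlgebra.IsSemisimple ℝ L] {𝔞 : LieSubalgebra ℝ L} [𝔞.IsCartanSubalgebra]
  [LieModule.IsTriangularizable ℝ 𝔞 L] {θ : L ≃ₗ⁅ℝ⁆ L} {X : LieModule.Weight ℝ 𝔞 L → L}

theorem IsNormalizedRootVectors.isSl2Triple (hX : IsNormalizedRootVectors θ X) (γ : 𝔞.root) :
    IsSl2Triple (coroot (γ : Weight ℝ 𝔞 L) : L) (X γ) (X (-(γ : Weight ℝ 𝔞 L))) := by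
  have hγ : (γ : Weight ℝ 𝔞 L).IsNonZero := LieSubalgebra.isNonZero_coe_root γ
  have he := hX.mem_rootSpace γ hγ
  have hf := hX.mem_rootSpace (-(γ : Weight ℝ 𝔞 L)) hγ.neg
  have h2 := root_apply_coroot hγ
  refine ⟨?_, ?_, ?_, ?_⟩
  · intro h
    have : coroot (γ : Weight ℝ 𝔞 L) = 0 := by exact_mod_cast h
    rw [this] at h2
    simp at h2
  · rw [lie_eq_killingForm_smul_of_mem_rootSpace_of_mem_rootSpace_neg he hf,
      hX.killingForm_neg γ hγ, coroot, rootNormSq, div_eq_mul_inv]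
    rw [← Nat.cast_smul_eq_nsmul ℝ, smul_smul]
    rfl
  · have := lie_eq_smul_of_mem_rootSpace he (coroot (γ : Weight ℝ 𝔞 L))
    rw [h2] at this
    rw [two_nsmul, ← two_smul ℝ]
    exact this
  · have := lie_eq_smul_of_mem_rootSpace hf (coroot (γ : Weight ℝ 𝔞 L))
    rw [Weight.coe_neg, Pi.neg_apply, h2, neg_smul] at this
    rw [two_nsmul, ← two_smul ℝ]
    exact this

theorem IsNormalizedRootVectors.lie_coroot (hX : IsNormalizedRootVectors θ X) (γ δ : 𝔞.root) :
    ⁅((coroot (γ : Weight ℝ 𝔞 L) : 𝔞) : L), X δ⁆ = (rootSystem 𝔞).pairing δ γ • X δ :=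
  lie_eq_smul_of_mem_rootSpace (hX.mem_rootSpace δ (LieSubalgebra.isNonZero_coe_root δ)) _

theorem IsNormalizedRootVectors.lie_neg_eq_zero (hX : IsNormalizedRootVectors θ X)
    (b : (rootSystem 𝔞).Base) {γ δ : 𝔞.root} (hγ : γ ∈ b.support) (hδ : δ ∈ b.support)
    (hne : γ ≠ δ) : ⁅X (-(γ : Weight ℝ 𝔞 L)), X δ⁆ = 0 := by
  have hγ0 : (γ : Weight ℝ 𝔞 L).IsNonZero := LieSubalgebra.isNonZero_coe_root γ
  have h1 : ⁅X (-(γ : Weight ℝ 𝔞 L)), X δ⁆ ∈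
      rootSpace 𝔞 (⇑(-(γ : Weight ℝ 𝔞 L)) + ⇑(δ : Weight ℝ 𝔞 L)) :=
    lie_mem_genWeightSpace_of_mem_genWeightSpace (hX.mem_rootSpace _ hγ0.neg)
    (hX.mem_rootSpace δ (LieSubalgebra.isNonZero_coe_root δ))
  by_contra h0
  have hbot : rootSpace 𝔞 (⇑(-(γ : Weight ℝ 𝔞 L)) + ⇑(δ : Weight ℝ 𝔞 L)) ≠ ⊥ := by
    intro h
    rw [h] at h1
    exact h0 ((LieSubmodule.mem_bot _).1 h1)
  let μ : Weight ℝ 𝔞 L := ⟨_, hbot⟩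
  have hμ : (μ : 𝔞 → ℝ) = ⇑(δ : Weight ℝ 𝔞 L) - ⇑(γ : Weight ℝ 𝔞 L) := by
    show ⇑(-(γ : Weight ℝ 𝔞 L)) + ⇑(δ : Weight ℝ 𝔞 L) = _
    rw [Weight.coe_neg]
    exact neg_add_eq_sub _ _
  have hμ0 : μ.IsNonZero := by
    intro h
    refine hne (Subtype.ext (DFunLike.coe_injective ?_)).symm
    rw [← sub_eq_zero, ← hμ]
    exact h
  refine b.sub_notMem_range_root hδ hγ ⟨⟨μ, by simpa using hμ0⟩, ?_⟩
  ext x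
  simpa using congrFun hμ x

theorem rootNormSq_mul_pairing (γ δ : 𝔞.root) :
    rootNormSq (γ : Weight ℝ 𝔞 L) * (rootSystem 𝔞).pairing δ γ =
      rootNormSq (δ : Weight ℝ 𝔞 L) * (rootSystem 𝔞).pairing γ δ := by
  have key : ∀ γ δ : 𝔞.root, rootNormSq (γ : Weight ℝ 𝔞 L) * (rootSystem 𝔞).pairing δ γ =
      2 * traceForm ℝ 𝔞 L ((cartanEquivDual 𝔞).symm (Weight.toLinear ℝ 𝔞 L δ))
        ((cartanEquivDual 𝔞).symm (Weight.toLinear ℝ 𝔞 L γ)) := by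
    intro γ δ
    have h0 : rootNormSq (γ : Weight ℝ 𝔞 L) ≠ 0 :=
      root_apply_cartanEquivDual_symm_ne_zero (LieSubalgebra.isNonZero_coe_root γ)
    have h1 : ∀ x, traceForm ℝ 𝔞 L ((cartanEquivDual 𝔞).symm (Weight.toLinear ℝ 𝔞 L δ)) x =
        (δ : Weight ℝ 𝔞 L) x := by
      intro x
      exact congrArg (fun f : Module.Dual ℝ 𝔞 => f x)
        ((cartanEquivDual 𝔞).apply_symm_apply (Weight.toLinear ℝ 𝔞 L δ))
    rw [h1, rootSystem_pairing_apply, coroot]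
    have h2 : ∀ (c : ℝ) (x : 𝔞), (δ : Weight ℝ 𝔞 L) (2 • c • x) =
        2 * (c * (δ : Weight ℝ 𝔞 L) x) := by
      intro c x
      rw [← Weight.toLinear_apply, map_nsmul, map_smul]
      simp
    rw [h2]
    change rootNormSq (γ : Weight ℝ 𝔞 L) * (2 * ((rootNormSq (γ : Weight ℝ 𝔞 L))⁻¹ * _)) = _
    field_simp
  rw [key, key, traceForm_comm]

theorem IsDoubleEdgeShort.ne {α β : 𝔞.root} (h : IsDoubleEdgeShort α β) : α ≠ β := by
  rintro rfl
  exact lt_irrefl _ h.short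

theorem IsNormalizedRootVectors.rootNormSq_pos (hX : IsNormalizedRootVectors θ X)
    (hθ : IsCartanInvolution θ) (γ : 𝔞.root) : 0 < rootNormSq (γ : Weight ℝ 𝔞 L) := by
  have hγ := LieSubalgebra.isNonZero_coe_root γ
  have h1 := hθ.pos _ (hX.isSl2Triple γ).e_ne_zero
  rw [← map_neg, ← hX.neg γ hγ, hX.killingForm_neg γ hγ] at h1
  exact (div_pos_iff_of_pos_left two_pos).1 h1

theorem IsDoubleEdgeShort.pairing_eq {α β : 𝔞.root} (h : IsDoubleEdgeShort α β)
    (hθ : IsCartanInvolution θ) (hX : IsNormalizedRootVectors θ X)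
    (b : (rootSystem 𝔞).Base) (hα : α ∈ b.support) (hβ : β ∈ b.support) :
    (rootSystem 𝔞).pairing α β = -1 ∧ (rootSystem 𝔞).pairing β α = -2 := by
  have hp := b.pairingIn_le_zero_of_ne h.ne hα hβ
  have hq := b.pairingIn_le_zero_of_ne h.ne.symm hβ hα
  have hd := h.double
  have hN := rootNormSq_mul_pairing α β
  have hpos := hX.rootNormSq_pos hθ β
  have hshort := h.short
  rw [RootPairing.coxeterWeight] at hd
  rw [← (rootSystem 𝔞).algebraMap_pairingIn ℤ α β, ← (rootSystem 𝔞).algebraMap_pairingIn ℤ β α]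
    at *
  generalize (rootSystem 𝔞).pairingIn ℤ α β = p at *
  generalize (rootSystem 𝔞).pairingIn ℤ β α = q at *
  simp only [algebraMap_int_eq, Int.coe_castRingHom] at *
  have hd' : p * q = 2 := by exact_mod_cast hd
  have hq1 : q ≤ -1 := by
    rcases hq.lt_or_eq with h | h
    · omega
    · simp [h] at hd'
  have hp2 : -2 ≤ p := by nlinarith
  interval_cases p
  · obtain rfl : q = -1 := by omega
    push_cast at hN
    linarith
  · obtain rfl : q = -2 := by omega
    norm_num
  · omega

theorem IsNormalizedRootVectors.map_sub_neg (hX : IsNormalizedRootVectors θ X)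
    (hθ : IsCartanInvolution θ) (γ : 𝔞.root) :
    X γ - X (-(γ : Weight ℝ 𝔞 L)) = X γ + θ (X γ) ∧
      θ (X γ - X (-(γ : Weight ℝ 𝔞 L))) = X γ - X (-(γ : Weight ℝ 𝔞 L)) := by
  rw [hX.neg γ (LieSubalgebra.isNonZero_coe_root γ)]
  refine ⟨by abel, ?_⟩
  rw [sub_neg_eq_add, map_add, hθ.involutive, add_comm]

/-- The relations between the generators `A_α`, `A_β` for a double edge. -/
theorem IsDoubleEdgeShort.lie_relations (hθ : IsCartanInvolution θ)
    (hX : IsNormalizedRootVectors θ X) {α β : 𝔞.root} (h : IsDoubleEdgeShort α β)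
    (b : (rootSystem 𝔞).Base) (hα : α ∈ b.support) (hβ : β ∈ b.support) {A B : L}
    (hA : A = X α - X (-(α : Weight ℝ 𝔞 L))) (hB : B = X β - X (-(β : Weight ℝ 𝔞 L))) :
    ⁅B, ⁅B, A⁆⁆ = -A ∧ ⁅A, ⁅A, ⁅A, B⁆⁆⁆ = -((4 : ℝ) • ⁅A, B⁆) := by
  obtain ⟨hp, hq⟩ := h.pairing_eq hθ hX b hα hβ
  obtain ⟨hA1, hA2⟩ := hX.map_sub_neg hθ α
  obtain ⟨hB1, hB2⟩ := hX.map_sub_neg hθ β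
  have h1 := (hX.isSl2Triple β).lie_sub_lie_sub_of_weight_one
    (hX.lie_neg_eq_zero b hβ hα h.ne.symm) (by rw [hX.lie_coroot, hp, neg_one_smul])
  have h2 := (hX.isSl2Triple α).lie_sub_pow_three_of_weight_two
    (hX.lie_neg_eq_zero b hα hβ h.ne) (by rw [hX.lie_coroot, hq, neg_smul])
  rw [← hA] at hA1 hA2 h2
  rw [← hB] at hB1 hB2 h1
  have h1' := congrArg θ h1
  have h2' := congrArg θ h2
  simp only [LieEquiv.map_lie, map_neg, map_smul, hA2, hB2] at h1' h2'
  constructor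
  · rw [hA1, lie_add, lie_add, h1, h1']
    abel
  · rw [hB1, lie_add, lie_add, lie_add, h2, h2', smul_add]
    abel

end RootVectors

section BraidRelations

variable {E : Type*} [NormedAddCommGroup E] [NormedSpace ℝ E] [FiniteDimensional ℝ E]
  {G : Type*} [TopologicalSpace G] [T2Space G] [ChartedSpace E G] [Group G]
  [LieGroup 𝓘(ℝ, E) ∞ G]

theorem mul_lieExp_smul_eq {g : G} {X Y : GroupLieAlgebra 𝓘(ℝ, E) G} (h : lieAd g X = Y)
    (t : ℝ) : g * lieExp (t • X) = lieExp (t • Y) * g := by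
  rw [← h, ← conj_lieExp_smul_eq, inv_mul_cancel_right]

/-- The braid relations of a double edge, from the brackets of the generators. -/
theorem double_edge_relations {A B : GroupLieAlgebra 𝓘(ℝ, E) G}
    (h1 : ⁅B, ⁅B, A⁆⁆ = -A) (h2 : ⁅A, ⁅A, ⁅A, B⁆⁆⁆ = -((4 : ℝ) • ⁅A, B⁆)) {sA sB : G}
    (hsA : sA = lieExp ((Real.pi / 2) • A)) (hsB : sB = lieExp ((Real.pi / 2) • B)) (t : ℝ) :
    (lieExp (t • A) * sB * sA * sB = sB * sA * sB * lieExp (t • A)) ∧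
    (sA * lieExp (t • B) * sA * sB = sB * sA * lieExp (t • B) * sA) ∧
    (sA * sB * lieExp (t • A) * sB = sB * lieExp ((Real.pi - t) • A) * sB * sA) ∧
    (sA * sB * sA * lieExp (t • B) = lieExp (t • B) * sA * sB * sA) := by
  obtain ⟨Y, hY⟩ : ∃ Y, Y = ⁅B, A⁆ := ⟨_, rfl⟩
  have hAB : ⁅A, B⁆ = -Y := by rw [hY, lie_skew]
  have hBY : ⁅B, Y⁆ = -A := hY ▸ h1
  have hAAY : ⁅A, ⁅A, Y⁆⁆ = -((2 : ℝ) ^ 2 • Y) := by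
    rw [hAB] at h2
    simp only [lie_neg, smul_neg, neg_neg] at h2
    rw [← neg_eq_iff_eq_neg.2 h2.symm]
    norm_num
  obtain ⟨Z, hZ⟩ : ∃ Z, Z = B - (2⁻¹ : ℝ) • ⁅A, Y⁆ := ⟨_, rfl⟩
  have hBZ : ⁅B, Z⁆ = 0 := by
    rw [hZ, lie_sub, lie_smul, leibniz_lie, ← hY, hBY]
    simp
  have hAsum : ⁅A, B + Z⁆ = 0 := by
    rw [hZ, lie_add, lie_sub, lie_smul, hAAY, hAB]
    module
  have hAdiff : ⁅A, B - Z⁆ = -((2 : ℝ) • Y) := by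
    rw [hZ, lie_sub, lie_sub, lie_smul, hAAY, hAB]
    module
  have hAAdiff : ⁅A, -((2 : ℝ) • Y)⁆ = -((2 : ℝ) ^ 2 • (B - Z)) := by
    rw [hZ, lie_neg, lie_smul]
    module
  have hpi : 2 * (Real.pi / 2) = Real.pi := by ring
  have aBA : lieAd sB A = Y := by
    rw [hsB, lieAd_lieExp_of_rotation one_ne_zero hY.symm (by rw [hBY]; simp)]
    simp
  have aBY : lieAd sB Y = -A := by
    rw [hsB, lieAd_lieExp_of_rotation one_ne_zero hBY (by rw [lie_neg, ← hY]; simp)]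
    simp
  have aAY : lieAd sA Y = -Y := by
    rw [hsA, lieAd_lieExp_of_rotation two_ne_zero rfl hAAY, hpi]
    simp
  have asum : lieAd sA (B + Z) = B + Z := by
    rw [hsA, lieAd_lieExp_of_lie_eq_zero hAsum]
  have adiff : lieAd sA (B - Z) = -(B - Z) := by
    rw [hsA, lieAd_lieExp_of_rotation two_ne_zero hAdiff hAAdiff, hpi]
    simp
  have aAB : lieAd sA B = Z := by
    have : B = (2⁻¹ : ℝ) • (B + Z) + (2⁻¹ : ℝ) • (B - Z) := by module
    rw [this, lieAd_add, lieAd_smul, lieAd_smul, asum, adiff]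
    module
  have aAZ : lieAd sA Z = B := by
    have : Z = (2⁻¹ : ℝ) • (B + Z) + (-2⁻¹ : ℝ) • (B - Z) := by module
    rw [this, lieAd_add, lieAd_smul, lieAd_smul, asum, adiff]
    module
  have aBZ : lieAd sB Z = Z := by
    rw [hsB, lieAd_lieExp_of_lie_eq_zero hBZ]
  have r1 := mul_lieExp_smul_eq aBA
  have r2 : ∀ s : ℝ, sB * lieExp (s • Y) = lieExp ((-s) • A) * sB := fun s => by
    rw [mul_lieExp_smul_eq aBY, smul_neg, neg_smul]
  have r3 : ∀ s : ℝ, sA * lieExp (s • Y) = lieExp ((-s) • Y) * sA := fun s => by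
    rw [mul_lieExp_smul_eq aAY, smul_neg, neg_smul]
  have r4 := mul_lieExp_smul_eq aAB
  have r5 := mul_lieExp_smul_eq aAZ
  have r6 := mul_lieExp_smul_eq aBZ
  have comm : sA * sA * sB = sB * (sA * sA) := by
    rw [hsB, mul_assoc, r4, ← mul_assoc, r5, mul_assoc]
  have sqA : sA * sA = lieExp (Real.pi • A) := by
    rw [hsA, ← lieExp_add_smul, add_halves]
  have hpiY : lieExp (Real.pi • Y) = sA * sA := by
    have h3 := r1 Real.pi
    rw [← sqA, ← comm] at h3
    exact (mul_right_cancel h3).symm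
  refine ⟨?_, ?_, ?_, ?_⟩
  · rw [mul_assoc (sB * sA) sB, r1, ← mul_assoc, mul_assoc sB sA, r3, ← mul_assoc, r2, neg_neg]
  · rw [r4, mul_assoc sB sA, r4, ← mul_assoc, r6]
    simp only [mul_assoc] at comm ⊢
    rw [comm]
  · rw [mul_assoc sA sB, r1, ← mul_assoc, r3, r1, mul_assoc (lieExp _) sB sB,
      mul_assoc (lieExp _) (sB * sB) sA]
    have h4 : sB * sB * sA = sA⁻¹ * (sB * sB) := by
      have h5 : sA⁻¹ = lieExp ((-(Real.pi / 2)) • A) := by rw [hsA, lieExp_neg_smul]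
      rw [h5, hsA, mul_assoc, r1, ← mul_assoc, r2, mul_assoc]
    rw [h4, sub_eq_add_neg, add_comm, lieExp_add_smul, hpiY]
    group
  · rw [mul_assoc (sA * sB), r4, ← mul_assoc, mul_assoc sA sB, r6, ← mul_assoc, r5]

end BraidRelations

theorem mainTheorem10
    {E : Type*} [NormedAddCommGroup E] [NormedSpace ℝ E] [FiniteDimensional ℝ E]
    {G : Type*} [TopologicalSpace G] [T2Space G] [ChartedSpace E G] [Group G]
    [LieGroup 𝓘(ℝ, E) ∞ G]
    [LieAlgebra.IsSemisimple ℝ (GroupLieAlgebra 𝓘(ℝ, E) G)]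
    (θ : GroupLieAlgebra 𝓘(ℝ, E) G ≃ₗ⁅ℝ⁆ GroupLieAlgebra 𝓘(ℝ, E) G) (hθ : IsCartanInvolution θ)
    (𝔞 : LieSubalgebra ℝ (GroupLieAlgebra 𝓘(ℝ, E) G)) (h𝔞 : ∀ h ∈ 𝔞, θ h = -h)
    [𝔞.IsCartanSubalgebra] [LieModule.IsTriangularizable ℝ 𝔞 (GroupLieAlgebra 𝓘(ℝ, E) G)]
    (b : (LieAlgebra.IsKilling.rootSystem 𝔞).Base)
    (X : LieModule.Weight ℝ 𝔞 (GroupLieAlgebra 𝓘(ℝ, E) G) → GroupLieAlgebra 𝓘(ℝ, E) G)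
    (hX : IsNormalizedRootVectors θ X)
    (α β : 𝔞.root) (hα : α ∈ b.support) (hβ : β ∈ b.support) (hαβ : IsDoubleEdgeShort α β)
    (t : ℝ) (ht : t ∈ Set.Icc 0 Real.pi) :
    (expRot X α t * reflRep X β * reflRep X α * reflRep X β =
      reflRep X β * reflRep X α * reflRep X β * expRot X α t) ∧
    (reflRep X α * expRot X β t * reflRep X α * reflRep X β =
      reflRep X β * reflRep X α * expRot X β t * reflRep X α) ∧
    (reflRep X α * reflRep X β * expRot X α t * reflRep X β =
      reflRep X β * expRot X α (Real.pi - t) * reflRep X β * reflRep X α) ∧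
    (reflRep X α * reflRep X β * reflRep X α * expRot X β t =
      expRot X β t * reflRep X α * reflRep X β * reflRep X α) := by
  obtain ⟨h1, h2⟩ := hαβ.lie_relations hθ hX b hα hβ (A := rotGen X α) (B := rotGen X β) rfl rfl
  exact double_edge_relations h1 h2 rfl rfl t
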